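/- Let $\mathbb{R}_F$ be the set of fuzzy numbers, i.e. of functions $u:\mathbb{R}\to[0,1]$ that are normal ($u(x)=1$ for some $x$), satisfy $u(tx+(1-t)y)\ge\min\{u(x),u(y)\}$ for $t\in[0,1]$, are upper semicontinuous, and have compact $\overline{\{u>0\}}$. Let $(u\oplus v)(x)=\sup_{y+z=x}\min\{u(y),v(z)\}$, $(\lambda\odot u)(x)=u(x/\lambda)$ for $\lambda\ne0$, $0\odot u=\widetilde 0=\chi_{\{0\}}$, and $D(u,v)=\sup_{r\in[0,1]}\max\{|u_-(r)-v_-(r)|,|u_+(r)-v_+(r)|\}$, where $[u_-(r),u_+(r)]$ is the level set $\{u\ge r\}$ for $r>0$ and $\overline{\{u>0\}}$ for $r=0$. Let $C([a,b];\mathbb{R}_F)$ be the space of continuous functions $[a,b]\to(\mathbb{R}_F,D)$ with pointwise $\oplus,\odot$ and the metric $D^*(f,g)=\sup_{x\in[a,b]}D(f(x),g(x))$, and let $X=C([a,b];\mathbb{R}_F)^2$ with componentwise operations and the box (maximum) metric $d$. An operator $A:X\to X$ belongs to $L(X)$ if $A(x\oplus y)=A(x)\oplus A(y)$, $A(\lambda\odot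 x)=\lambda\odot A(x)$ for all $\lambda\in\mathbb{R}$, and $A$ is continuous. For $A\in L(X)$, $e^{t\odot A}$ denotes the operator $T\in L(X)$ with $$\lim_{m\to\infty}\Phi\Big(T,\sum_{p=0}^m\tfrac{t^p}{p!}\odot A^p\Big)=0,\qquad \Phi(A,B)=\sup\{d(A(x),B(x)):d(\widetilde0,x)\le1\},$$ where the sum is taken with respect to $\oplus$. A function $f:[0,\infty)\to C([a,b];\mathbb{R}_F)$ has Hukuhara derivative $f'(t)$ at $t>0$ if for all small $h>0$ there are $p_h,q_h$ with $f(t+h)=f(t)\oplus p_h$, $f(t)=f(t-h)\oplus q_h$, and $\frac1h\odot p_h\to f'(t)$, $\frac1h\odot q_h\to f'(t)$ in $D^*$ as $h\searrow0$; at $t=0$ only the condition on $p_h$ is imposed. Let $\widetilde A:X\to X$, $\widetilde A(u,v)=\big(u\oplus v,\ (-1)\odot(u\oplus v)\big)$, and put $E(u,v)=(u\oplus v)\oplus(-1)\odot(u\oplus v)$ and $h(t)=\frac14(e^{2t}-2t-1)$. Then $\widetilde A\in L(X)$; for every $t\ge0$ the operator $e^{t\odot\widetilde A}$ exists, is unique,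 and is given by $$e^{t\odot\widetilde A}(u_0,v_0)=\Big(u_0\oplus t\odot(u_0\oplus v_0)\oplus h(t)\odot E(u_0,v_0),\ \ v_0\oplus(-t)\odot(u_0\oplus v_0)\oplus h(t)\odot E(u_0,v_0)\Big);$$ and for all $u_0,v_0\in C([a,b];\mathbb{R}_F)$ the functions $$u(t)=u_0\oplus t\odot(u_0\oplus v_0)\oplus h(t)\odot E(u_0,v_0),\qquad v(t)=v_0\oplus(-t)\odot(u_0\oplus v_0)\oplus h(t)\odot E(u_0,v_0)$$ solve, with Hukuhara derivatives in $t$, the fuzzy system $$u'(t)=u(t)\oplus v(t),\quad v'(t)=(-1)\odot u(t)\oplus(-1)\odot v(t)\quad(t\ge0),\qquad u(0)=u_0,\ v(0)=v_0.$$ -/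

import Mathlib

noncomputable section FuzzyPart

open Set Filter Topology
open scoped Pointwise

/-- Fuzzy numbers `ℝ_F`: normal, convex, upper semicontinuous fuzzy subsets `u : ℝ → [0,1]` of the
real line with compact closure of the support. -/
@[ext]
structure FuzzyNumber where
  toFun : ℝ → ℝ
  mem_unit : ∀ x, toFun x ∈ Icc (0 : ℝ) 1
  normal : ∃ x, toFun x = 1
  convex : ∀ t ∈ Icc (0 : ℝ) 1, ∀ x y, min (toFun x) (toFun y) ≤ toFun (t * x + (1 - t) * y)
  usc : UpperSemicontinuous toFun
  compact_supp : IsCompact (closure {x | 0 < toFun x})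

namespace FuzzyNumber

/-- The `r`-level set `[u]^r`, for `r ∈ [0,1]`. -/
def level (u : FuzzyNumber) (r : ℝ) : Set ℝ :=
  if r = 0 then closure {x | 0 < u.toFun x} else {x | r ≤ u.toFun x}

/-- Left endpoint `u_-(r)` of the level set. -/
def lo (u : FuzzyNumber) (r : ℝ) : ℝ := sInf (u.level r)

/-- Right endpoint `u_+(r)` of the level set. -/
def hi (u : FuzzyNumber) (r : ℝ) : ℝ := sSup (u.level r)

lemma level_zero (u : FuzzyNumber) : u.level 0 = closure {x | 0 < u.toFun x} := if_pos rfl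

lemma level_pos (u : FuzzyNumber) {r : ℝ} (hr : 0 < r) : u.level r = {x | r ≤ u.toFun x} :=
  if_neg hr.ne'

lemma convex_sep {f : ℝ → ℝ} (hf : ∀ t ∈ Icc (0 : ℝ) 1, ∀ x y,
    min (f x) (f y) ≤ f (t * x + (1 - t) * y)) (p : ℝ → Prop)
    (hp : ∀ s s', p s → s ≤ s' → p s') : Convex ℝ {x | p (f x)} := by
  intro x hx y hy s t hs ht hst
  have h := hf s ⟨hs, by linarith⟩ x y
  have e : t = 1 - s := by linarith
  subst e
  simp only [smul_eq_mul, mem_ofPred_eq] at *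
  rcases le_total (f x) (f y) with h1 | h1
  · rw [min_eq_left h1] at h; exact hp _ _ hx h
  · rw [min_eq_right h1] at h; exact hp _ _ hy h

lemma level_nonempty (u : FuzzyNumber) {r : ℝ} (hr : r ∈ Icc (0 : ℝ) 1) :
    (u.level r).Nonempty := by
  obtain ⟨x, hx⟩ := u.normal
  refine ⟨x, ?_⟩
  rcases hr.1.eq_or_lt with h | h
  · rw [← h, level_zero]; exact subset_closure (by simp [hx])
  · rw [level_pos _ h]; simpa [hx] using hr.2

lemma level_subset (u : FuzzyNumber) {r : ℝ} (hr : 0 ≤ r) : u.level r ⊆ u.level 0 := by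
  rcases hr.eq_or_lt with h | h
  · rw [← h]
  · rw [level_pos _ h, level_zero]; exact fun x hx => subset_closure (lt_of_lt_of_le h hx)

lemma level_compact (u : FuzzyNumber) {r : ℝ} (hr : 0 ≤ r) : IsCompact (u.level r) := by
  have h0 : IsCompact (u.level 0) := by rw [level_zero]; exact u.compact_supp
  rcases hr.eq_or_lt with h | h
  · rwa [← h]
  · refine h0.of_isClosed_subset ?_ (u.level_subset hr)
    rw [level_pos _ h]
    exact u.usc.isClosed_preimage r

lemma level_convex (u : FuzzyNumber) {r : ℝ} (hr : 0 ≤ r) : Convex ℝ (u.level r) := by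
  rcases hr.eq_or_lt with h | h
  · rw [← h, level_zero]
    exact (convex_sep u.convex (fun s => 0 < s) fun _ _ h h' => lt_of_lt_of_le h h').closure
  · rw [level_pos _ h]
    exact convex_sep u.convex (fun s => r ≤ s) fun _ _ h h' => le_trans h h'

lemma level_eq_Icc (u : FuzzyNumber) {r : ℝ} (hr : r ∈ Icc (0 : ℝ) 1) :
    u.level r = Icc (u.lo r) (u.hi r) :=
  eq_Icc_of_connected_compact
    ⟨u.level_nonempty hr, (u.level_convex hr.1).isPreconnected⟩ (u.level_compact hr.1)

lemma ext_level {u v : FuzzyNumber} (h : ∀ r ∈ Icc (0 : ℝ) 1, u.level r = v.level r) : u = v := by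
  have key : ∀ {u v : FuzzyNumber}, (∀ r ∈ Icc (0 : ℝ) 1, u.level r = v.level r) →
      ∀ x, u.toFun x ≤ v.toFun x := by
    intro u v h x
    rcases (u.mem_unit x).1.eq_or_lt with h0 | h0
    · rw [← h0]; exact (v.mem_unit x).1
    · have := h _ (u.mem_unit x)
      rw [level_pos _ h0, level_pos _ h0] at this
      have hx : x ∈ {y | u.toFun x ≤ u.toFun y} := le_refl (u.toFun x)
      rw [this] at hx
      exact hx
  ext x
  exact le_antisymm (key h x) (key (fun r hr => (h r hr).symm) x)

lemma ext_lo_hi {u v : FuzzyNumber} (h : ∀ r ∈ Icc (0 : ℝ) 1, u.lo r = v.lo r ∧ u.hi r = v.hi r) :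
    u = v :=
  ext_level fun r hr => by rw [level_eq_Icc _ hr, level_eq_Icc _ hr, (h r hr).1, (h r hr).2]

/-! ### The real number zero -/

/-- `0̃ = χ_{0}`. -/
instance : Zero FuzzyNumber where
  zero :=
    { toFun := ({0} : Set ℝ).indicator 1
      mem_unit := fun x => by by_cases h : x = 0 <;> simp [h]
      normal := ⟨0, by simp⟩
      convex := fun t ht x y => by
        by_cases hx : x = 0
        · by_cases hy : y = 0
          · simp [hx, hy]
          · rw [min_eq_right]
            · rw [indicator_of_notMem (by simpa using hy)]
              exact indicator_nonneg (by simp) _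
            · simp [hx, hy]
        · rw [min_eq_left]
          · rw [indicator_of_notMem (by simpa using hx)]
            exact indicator_nonneg (by simp) _
          · rw [indicator_of_notMem (by simpa using hx)]
            exact indicator_nonneg (by simp) _
      usc := isClosed_singleton.upperSemicontinuous_indicator zero_le_one
      compact_supp := by
        have : {x : ℝ | 0 < ({0} : Set ℝ).indicator (1 : ℝ → ℝ) x} = {0} := by
          ext x; by_cases h : x = 0 <;> simp [h]
        rw [this, closure_singleton]; exact isCompact_singleton }

lemma zero_toFun (x : ℝ) : (0 : FuzzyNumber).toFun x = ({0} : Set ℝ).indicator 1 x := rfl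

lemma level_zero_number {r : ℝ} (hr : r ∈ Icc (0 : ℝ) 1) : (0 : FuzzyNumber).level r = {0} := by
  rcases hr.1.eq_or_lt with h | h
  · rw [← h, level_zero]
    have : {x : ℝ | 0 < (0 : FuzzyNumber).toFun x} = {0} := by
      ext x; by_cases h : x = 0 <;> simp [zero_toFun, h]
    rw [this, closure_singleton]
  · rw [level_pos _ h]
    ext x; by_cases hx : x = 0
    · simpa [zero_toFun, hx] using hr.2
    · simpa [zero_toFun, hx] using h

/-! ### Addition -/

/-- The function `x ↦ sup_{y + z = x} min (u y) (v z)`. -/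
def addFun (u v : FuzzyNumber) (x : ℝ) : ℝ := ⨆ y : ℝ, min (u.toFun y) (v.toFun (x - y))

lemma addFun_bdd (u v : FuzzyNumber) (x : ℝ) :
    BddAbove (range fun y : ℝ => min (u.toFun y) (v.toFun (x - y))) :=
  ⟨1, by rintro _ ⟨y, rfl⟩; exact (min_le_left _ _).trans (u.mem_unit y).2⟩

lemma le_addFun (u v : FuzzyNumber) (x y : ℝ) :
    min (u.toFun y) (v.toFun (x - y)) ≤ addFun u v x := le_ciSup (addFun_bdd u v x) y

lemma addFun_attained (u v : FuzzyNumber) (x : ℝ) :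
    ∃ y, addFun u v x = min (u.toFun y) (v.toFun (x - y)) := by
  have husc : UpperSemicontinuous fun y : ℝ => min (u.toFun y) (v.toFun (x - y)) := by
    rw [upperSemicontinuous_iff_isClosed_preimage]
    intro r
    have h1 := u.usc.isClosed_preimage r
    have h2 := (v.usc.isClosed_preimage r).preimage (continuous_const.sub continuous_id :
      Continuous fun y : ℝ => x - y)
    convert h1.inter h2 using 1
    ext y; simp
  have hne := u.level_nonempty (r := 0) (by simp)
  have hc := u.level_compact (r := 0) le_rfl
  obtain ⟨y, hy, hmax⟩ := (husc.upperSemicontinuousOn (u.level 0)).exists_isMaxOn hne hc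
  refine ⟨y, le_antisymm (ciSup_le fun z => ?_) (le_addFun u v x y)⟩
  by_cases hz : z ∈ u.level 0
  · exact hmax hz
  · have : u.toFun z = 0 := by
      refine le_antisymm (not_lt.1 fun h => hz ?_) (u.mem_unit z).1
      rw [level_zero]; exact subset_closure h
    exact ((min_le_left _ _).trans this.le).trans
      (le_min (u.mem_unit _).1 (v.mem_unit _).1)

lemma addFun_sep (u v : FuzzyNumber) (p : ℝ → Prop) (hp : ∀ s s', p s → s ≤ s' → p s') :
    {x | p (addFun u v x)} = {x | p (u.toFun x)} + {x | p (v.toFun x)} := by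
  ext x
  constructor
  · intro hx
    obtain ⟨y, hy⟩ := addFun_attained u v x
    simp only [mem_ofPred_eq, hy] at hx
    exact ⟨y, hp _ _ hx (min_le_left _ _), x - y, hp _ _ hx (min_le_right _ _), by simp⟩
  · rintro ⟨y, hy, z, hz, rfl⟩
    have h := le_addFun u v (y + z) y
    rw [add_sub_cancel_left] at h
    refine hp _ _ ?_ h
    rcases min_choice (u.toFun y) (v.toFun z) with e | e <;> rw [e] <;> assumption

lemma closure_add_supp (u v : FuzzyNumber) :
    closure {x | 0 < addFun u v x} = u.level 0 + v.level 0 := by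
  rw [addFun_sep u v (fun s => 0 < s) fun _ _ h h' => lt_of_lt_of_le h h']
  refine subset_antisymm ?_ ?_
  · refine closure_minimal ?_
      ((u.level_compact le_rfl).add (v.level_compact le_rfl)).isClosed
    rw [level_zero, level_zero]
    exact add_subset_add subset_closure subset_closure
  · rw [level_zero, level_zero]
    rintro _ ⟨y, hy, z, hz, rfl⟩
    exact map_mem_closure₂ continuous_add hy hz fun a ha b hb => add_mem_add ha hb

/-- `(u ⊕ v)(x) = sup_{y + z = x} min (u y) (v z)`. -/
instance : Add FuzzyNumber where
  add u v :=
    { toFun := addFun u v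
      mem_unit := fun x => by
        obtain ⟨y, hy⟩ := addFun_attained u v x
        rw [hy]
        exact ⟨le_min (u.mem_unit _).1 (v.mem_unit _).1, (min_le_left _ _).trans (u.mem_unit y).2⟩
      normal := by
        obtain ⟨x, hx⟩ := u.normal
        obtain ⟨y, hy⟩ := v.normal
        refine ⟨x + y, le_antisymm ?_ ?_⟩
        · exact ciSup_le fun z => (min_le_left _ _).trans (u.mem_unit z).2
        · simpa [hx, hy] using le_addFun u v (x + y) x
      convex := fun t ht x y => by
        obtain ⟨a, ha⟩ := addFun_attained u v x
        obtain ⟨b, hb⟩ := addFun_attained u v y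
        have h := le_addFun u v (t * x + (1 - t) * y) (t * a + (1 - t) * b)
        have e : t * x + (1 - t) * y - (t * a + (1 - t) * b)
            = t * (x - a) + (1 - t) * (y - b) := by ring
        rw [e] at h
        refine le_trans ?_ h
        rw [ha, hb]
        refine le_min (le_trans ?_ (u.convex t ht a b)) (le_trans ?_ (v.convex t ht _ _))
        · exact min_le_min (min_le_left _ _) (min_le_left _ _)
        · exact min_le_min (min_le_right _ _) (min_le_right _ _)
      usc := by
        rw [upperSemicontinuous_iff_isClosed_preimage]
        intro r
        rcases le_or_gt r 0 with hr | hr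
        · convert isClosed_univ using 1
          refine eq_univ_of_forall fun x => hr.trans ?_
          obtain ⟨y, hy⟩ := addFun_attained u v x
          rw [hy]
          exact le_min (u.mem_unit _).1 (v.mem_unit _).1
        · have h := addFun_sep u v (fun s => r ≤ s) fun _ _ h h' => le_trans h h'
          rw [← level_pos u hr, ← level_pos v hr] at h
          change IsClosed {x | r ≤ addFun u v x}
          rw [h]
          exact ((u.level_compact hr.le).add (v.level_compact hr.le)).isClosed
      compact_supp := by
        rw [closure_add_supp]
        exact (u.level_compact le_rfl).add (v.level_compact le_rfl) }

lemma level_add (u v : FuzzyNumber) {r : ℝ} (hr : 0 ≤ r) :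
    (u + v).level r = u.level r + v.level r := by
  rcases hr.eq_or_lt with h | h
  · rw [← h, level_zero]; exact closure_add_supp u v
  · rw [level_pos _ h, level_pos _ h, level_pos _ h]
    exact addFun_sep u v (fun s => r ≤ s) fun _ _ h h' => le_trans h h'

lemma lo_add (u v : FuzzyNumber) {r : ℝ} (hr : r ∈ Icc (0 : ℝ) 1) :
    (u + v).lo r = u.lo r + v.lo r := by
  rw [lo, level_add u v hr.1]
  exact csInf_add (u.level_nonempty hr) (u.level_compact hr.1).bddBelow
    (v.level_nonempty hr) (v.level_compact hr.1).bddBelow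

lemma hi_add (u v : FuzzyNumber) {r : ℝ} (hr : r ∈ Icc (0 : ℝ) 1) :
    (u + v).hi r = u.hi r + v.hi r := by
  rw [hi, level_add u v hr.1]
  exact csSup_add (u.level_nonempty hr) (u.level_compact hr.1).bddAbove
    (v.level_nonempty hr) (v.level_compact hr.1).bddAbove

lemma lo_zero {r : ℝ} (hr : r ∈ Icc (0 : ℝ) 1) : (0 : FuzzyNumber).lo r = 0 := by
  rw [lo, level_zero_number hr, csInf_singleton]

lemma hi_zero {r : ℝ} (hr : r ∈ Icc (0 : ℝ) 1) : (0 : FuzzyNumber).hi r = 0 := by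
  rw [hi, level_zero_number hr, csSup_singleton]

instance : AddCommMonoid FuzzyNumber where
  add_assoc u v w := ext_lo_hi fun r hr => by
    simp only [lo_add _ _ hr, hi_add _ _ hr, add_assoc, and_self]
  zero_add u := ext_lo_hi fun r hr => by
    simp only [lo_add _ _ hr, hi_add _ _ hr, lo_zero hr, hi_zero hr, zero_add, and_self]
  add_zero u := ext_lo_hi fun r hr => by
    simp only [lo_add _ _ hr, hi_add _ _ hr, lo_zero hr, hi_zero hr, add_zero, and_self]
  add_comm u v := ext_lo_hi fun r hr => by
    rw [lo_add _ _ hr, hi_add _ _ hr, lo_add _ _ hr, hi_add _ _ hr]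
    exact ⟨add_comm _ _, add_comm _ _⟩
  nsmul := nsmulRec

/-! ### Scalar multiplication -/

lemma smul_supp (c : ℝ) (hc : c ≠ 0) (s : Set ℝ) : {x : ℝ | x / c ∈ s} = c • s := by
  ext x
  rw [mem_smul_set_iff_inv_smul_mem₀ hc, smul_eq_mul, inv_mul_eq_div]
  rfl

/-- The dilation `x ↦ u (x / c)` for `c ≠ 0`. -/
def dilate (c : ℝ) (hc : c ≠ 0) (u : FuzzyNumber) : FuzzyNumber where
  toFun x := u.toFun (x / c)
  mem_unit x := u.mem_unit _
  normal := by
    obtain ⟨x, hx⟩ := u.normal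
    exact ⟨c * x, by rwa [mul_div_cancel_left₀ _ hc]⟩
  convex t ht x y := by
    have := u.convex t ht (x / c) (y / c)
    rwa [← mul_div_assoc, ← mul_div_assoc, ← add_div] at this
  usc := u.usc.comp (continuous_id.div_const c)
  compact_supp := by
    have h : {x : ℝ | 0 < u.toFun (x / c)} = c • {x | 0 < u.toFun x} :=
      smul_supp c hc {x | 0 < u.toFun x}
    rw [h, closure_smul₀' hc]
    exact u.compact_supp.smul c

open Classical in
/-- `(c ⊙ u)(x) = u (x / c)` if `c ≠ 0`, and `0 ⊙ u = 0̃`. -/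
instance : SMul ℝ FuzzyNumber where
  smul c u := if hc : c = 0 then 0 else dilate c hc u

lemma zero_smul_def (u : FuzzyNumber) : (0 : ℝ) • u = 0 := dif_pos rfl

lemma smul_toFun {c : ℝ} (hc : c ≠ 0) (u : FuzzyNumber) (x : ℝ) :
    (c • u).toFun x = u.toFun (x / c) := by
  have : c • u = dilate c hc u := dif_neg hc
  rw [this]; rfl

lemma level_smul (c : ℝ) (u : FuzzyNumber) {r : ℝ} (hr : r ∈ Icc (0 : ℝ) 1) :
    (c • u).level r = c • u.level r := by
  by_cases hc : c = 0
  · subst hc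
    rw [zero_smul_def, level_zero_number hr, zero_smul_set (u.level_nonempty hr)]
    rfl
  · rcases hr.1.eq_or_lt with h | h
    · rw [← h, level_zero, level_zero, ← closure_smul₀' hc]
      simp only [smul_toFun hc]
      exact congrArg closure (smul_supp c hc {x | 0 < u.toFun x})
    · rw [level_pos _ h, level_pos _ h]
      simp only [smul_toFun hc]
      exact smul_supp c hc {x | r ≤ u.toFun x}

lemma lo_smul_nonneg {c : ℝ} (hc : 0 ≤ c) (u : FuzzyNumber) {r : ℝ} (hr : r ∈ Icc (0 : ℝ) 1) :
    (c • u).lo r = c * u.lo r := by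
  rw [lo, level_smul c u hr, Real.sInf_smul_of_nonneg hc]; rfl

lemma hi_smul_nonneg {c : ℝ} (hc : 0 ≤ c) (u : FuzzyNumber) {r : ℝ} (hr : r ∈ Icc (0 : ℝ) 1) :
    (c • u).hi r = c * u.hi r := by
  rw [hi, level_smul c u hr, Real.sSup_smul_of_nonneg hc]; rfl

lemma lo_smul_nonpos {c : ℝ} (hc : c ≤ 0) (u : FuzzyNumber) {r : ℝ} (hr : r ∈ Icc (0 : ℝ) 1) :
    (c • u).lo r = c * u.hi r := by
  rw [lo, level_smul c u hr, Real.sInf_smul_of_nonpos hc]; rfl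

lemma hi_smul_nonpos {c : ℝ} (hc : c ≤ 0) (u : FuzzyNumber) {r : ℝ} (hr : r ∈ Icc (0 : ℝ) 1) :
    (c • u).hi r = c * u.lo r := by
  rw [hi, level_smul c u hr, Real.sSup_smul_of_nonpos hc]; rfl

/-! ### The metric -/

/-- Distance of the `r`-level sets. -/
def distAt (u v : FuzzyNumber) (r : ℝ) : ℝ := max |u.lo r - v.lo r| |u.hi r - v.hi r|

/-- `D(u,v) = sup_{r ∈ [0,1]} max {|u_-(r) - v_-(r)|, |u_+(r) - v_+(r)|}`. -/
instance : Dist FuzzyNumber where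
  dist u v := ⨆ r : Icc (0 : ℝ) 1, distAt u v r

lemma dist_def (u v : FuzzyNumber) : dist u v = ⨆ r : Icc (0 : ℝ) 1, distAt u v r := rfl

lemma lo_hi_bounds (u : FuzzyNumber) {r : ℝ} (hr : r ∈ Icc (0 : ℝ) 1) :
    u.lo 0 ≤ u.lo r ∧ u.lo r ≤ u.hi r ∧ u.hi r ≤ u.hi 0 := by
  have h0 : (0 : ℝ) ∈ Icc (0 : ℝ) 1 := by simp
  have hne := u.level_nonempty hr
  rw [level_eq_Icc u hr, nonempty_Icc] at hne
  have hs := u.level_subset hr.1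
  rw [level_eq_Icc u hr, level_eq_Icc u h0, Icc_subset_Icc_iff hne] at hs
  exact ⟨hs.1, hne, hs.2⟩

lemma distAt_bdd (u v : FuzzyNumber) : BddAbove (range fun r : Icc (0 : ℝ) 1 => distAt u v r) := by
  refine ⟨|u.lo 0| + |u.hi 0| + (|v.lo 0| + |v.hi 0|), ?_⟩
  rintro _ ⟨r, rfl⟩
  have hu := lo_hi_bounds u r.2
  have hv := lo_hi_bounds v r.2
  refine max_le (abs_le.2 ⟨?_, ?_⟩) (abs_le.2 ⟨?_, ?_⟩) <;>
  linarith [neg_abs_le (u.lo 0), le_abs_self (u.lo 0), neg_abs_le (u.hi 0), le_abs_self (u.hi 0),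
    neg_abs_le (v.lo 0), le_abs_self (v.lo 0), neg_abs_le (v.hi 0), le_abs_self (v.hi 0)]

lemma distAt_le_dist (u v : FuzzyNumber) {r : ℝ} (hr : r ∈ Icc (0 : ℝ) 1) :
    distAt u v r ≤ dist u v := le_ciSup (distAt_bdd u v) ⟨r, hr⟩

lemma dist_le_of {u v : FuzzyNumber} {C : ℝ} (h : ∀ r ∈ Icc (0 : ℝ) 1, distAt u v r ≤ C) :
    dist u v ≤ C := ciSup_le fun r : Icc (0 : ℝ) 1 => h r r.2

instance : MetricSpace FuzzyNumber where
  dist_self u := by simp [dist_def, distAt]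
  dist_comm u v := by
    simp only [dist_def, distAt, abs_sub_comm]
  dist_triangle u v w := dist_le_of fun r hr => by
    have h1 := distAt_le_dist u v hr
    have h2 := distAt_le_dist v w hr
    simp only [distAt, max_le_iff] at *
    exact ⟨(abs_sub_le _ (v.lo r) _).trans (add_le_add h1.1 h2.1),
      (abs_sub_le _ (v.hi r) _).trans (add_le_add h1.2 h2.2)⟩
  eq_of_dist_eq_zero {u v} h := ext_lo_hi fun r hr => by
    have h1 := distAt_le_dist u v hr
    rw [h] at h1
    simp only [distAt, max_le_iff] at h1
    exact ⟨sub_eq_zero.1 (abs_nonpos_iff.1 h1.1), sub_eq_zero.1 (abs_nonpos_iff.1 h1.2)⟩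

lemma dist_add_add_le' (u v w e : FuzzyNumber) : dist (u + v) (w + e) ≤ dist u w + dist v e :=
  dist_le_of fun r hr => by
    have h1 := distAt_le_dist u w hr
    have h2 := distAt_le_dist v e hr
    simp only [distAt, max_le_iff, lo_add _ _ hr, hi_add _ _ hr, add_sub_add_comm] at *
    exact ⟨(abs_add_le _ _).trans (add_le_add h1.1 h2.1),
      (abs_add_le _ _).trans (add_le_add h1.2 h2.2)⟩

lemma dist_smul_le' (c : ℝ) (u v : FuzzyNumber) : dist (c • u) (c • v) ≤ |c| * dist u v :=
  dist_le_of fun r hr => by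
    have h1 := distAt_le_dist u v hr
    simp only [distAt, max_le_iff] at *
    rcases le_total 0 c with hc | hc
    · simp only [lo_smul_nonneg hc _ hr, hi_smul_nonneg hc _ hr, ← mul_sub, abs_mul]
      exact ⟨mul_le_mul_of_nonneg_left h1.1 (abs_nonneg c),
        mul_le_mul_of_nonneg_left h1.2 (abs_nonneg c)⟩
    · simp only [lo_smul_nonpos hc _ hr, hi_smul_nonpos hc _ hr, ← mul_sub, abs_mul]
      exact ⟨mul_le_mul_of_nonneg_left h1.2 (abs_nonneg c),
        mul_le_mul_of_nonneg_left h1.1 (abs_nonneg c)⟩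

instance : ContinuousAdd FuzzyNumber where
  continuous_add := by
    refine (LipschitzWith.of_dist_le_mul (K := 2) fun p q => ?_).continuous
    refine (dist_add_add_le' _ _ _ _).trans ?_
    rw [Prod.dist_eq, NNReal.coe_ofNat, two_mul]
    exact add_le_add (le_max_left _ _) (le_max_right _ _)

instance : ContinuousConstSMul ℝ FuzzyNumber where
  continuous_const_smul c := by
    refine (LipschitzWith.of_dist_le_mul (K := ‖c‖₊) fun p q => ?_).continuous
    exact dist_smul_le' c p q

end FuzzyNumber

end FuzzyPart

section FuzzyOperators

open Filter Topology

/-! ### Operators, exponentials and derivatives on spaces of fuzzy type `(X, ⊕, ⊙, d)`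

Here `⊕`, `⊙`, `0̃`, `d` are `+`, `•`, `0`, `dist`; scalar multiplication does not distribute over
the addition of scalars. -/

variable {X : Type*} [MetricSpace X] [AddCommMonoid X] [SMul ℝ X]

/-- `A ∈ L(X)`: `A` is additive, homogeneous for all real scalars, and continuous on `X`. -/
structure IsFuzzyOperator (A : X → X) : Prop where
  map_add : ∀ x y, A (x + y) = A x + A y
  map_smul : ∀ (c : ℝ) x, A (c • x) = c • A x
  continuous : Continuous A

/-- `Φ(A,B) = sup {d(A x, B x) : d(0̃, x) ≤ 1}`, as an extended nonnegative real number. -/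
noncomputable def operatorDist (A B : X → X) : ENNReal :=
  ⨆ x : X, ⨆ _ : dist 0 x ≤ 1, edist (A x) (B x)

/-- The partial sums `S_m(t) = ∑_{p=0}^m (t^p / p!) ⊙ A^p` of the exponential series. -/
noncomputable def expPartialSum (A : X → X) (t : ℝ) (m : ℕ) (x : X) : X :=
  ∑ p ∈ Finset.range (m + 1), (t ^ p / (p.factorial : ℝ)) • A^[p] x

/-- `T = e^{t ⊙ A}`: the operator `T ∈ L(X)` is the limit in the metric `Φ` of the partial sums of
the exponential series. -/
structure IsFuzzyExp (A : X → X) (t : ℝ) (T : X → X) : Prop where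
  isFuzzyOperator : IsFuzzyOperator T
  tendsto : Tendsto (fun m => operatorDist T (expPartialSum A t m)) atTop (𝓝 0)

/-- `w = x ⊖ y` (Hukuhara difference). -/
def IsHukuharaDiff (x y w : X) : Prop := x = y + w

/-- `f` has Hukuhara derivative `f'` at `t`, as a function on `S ⊆ ℝ`: for all small `h > 0` the
differences `f(t+h) ⊖ f(t) = p h` (if `t + h ∈ S`) and `f(t) ⊖ f(t-h) = q h` (if `t - h ∈ S`)
exist, and `(1/h) ⊙ p h → f'`, `(1/h) ⊙ q h → f'` as `h ↘ 0` (with `t + h ∈ S`, `t - h ∈ S`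
respectively). In the interior of `S` this is the usual two-sided Hukuhara derivative; at an
endpoint of an interval `S` it is the one-sided one. -/
def HasHukuharaDerivWithinAt (f : ℝ → X) (f' : X) (S : Set ℝ) (t : ℝ) : Prop :=
  ∃ h₀ > (0 : ℝ), ∃ p q : ℝ → X,
    (∀ h, 0 < h → h ≤ h₀ → t + h ∈ S → IsHukuharaDiff (f (t + h)) (f t) (p h)) ∧
    (∀ h, 0 < h → h ≤ h₀ → t - h ∈ S → IsHukuharaDiff (f t) (f (t - h)) (q h)) ∧
    Tendsto (fun h => dist ((1 / h) • p h) f') (𝓝[{h | 0 < h ∧ t + h ∈ S}] 0) (𝓝 0) ∧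
    Tendsto (fun h => dist ((1 / h) • q h) f') (𝓝[{h | 0 < h ∧ t - h ∈ S}] 0) (𝓝 0)

end FuzzyOperators

section FuzzySystem

/-- `C([a,b]; ℝ_F)` with the supremum metric `D*` and the pointwise operations. -/
abbrev FuzzyC (a b : ℝ) : Type := C(Set.Icc a b, FuzzyNumber)

/-- `Ã[(u,v)] = (u ⊕ v, (-1) ⊙ (u ⊕ v))` on `C([a,b]; ℝ_F)²` (with the box metric). -/
noncomputable def systemOperator (a b : ℝ) (w : FuzzyC a b × FuzzyC a b) :
    FuzzyC a b × FuzzyC a b :=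
  (w.1 + w.2, (-1 : ℝ) • (w.1 + w.2))

/-- `E(u,v) = (u ⊕ v) ⊕ (-1) ⊙ (u ⊕ v)`. -/
noncomputable def fuzzyE {a b : ℝ} (u v : FuzzyC a b) : FuzzyC a b :=
  (u + v) + (-1 : ℝ) • (u + v)

/-- `h(t) = (e^{2t} - 2t - 1) / 4`. -/
noncomputable def hFun (t : ℝ) : ℝ := (Real.exp (2 * t) - 2 * t - 1) / 4

/-- `(u, v)` solves `u' = u ⊕ v`, `v' = (-1) ⊙ u ⊕ (-1) ⊙ v`, `t ≥ 0`, with initial values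
`u₀, v₀`; the derivatives are Hukuhara derivatives of `C([a,b]; ℝ_F)`-valued functions on
`[0, ∞)`. -/
structure IsSystemSolution {a b : ℝ} (u₀ v₀ : FuzzyC a b) (u v : ℝ → FuzzyC a b) : Prop where
  init_u : u 0 = u₀
  init_v : v 0 = v₀
  deriv_u : ∀ t, 0 ≤ t → HasHukuharaDerivWithinAt u (u t + v t) (Set.Ici 0) t
  deriv_v : ∀ t, 0 ≤ t →
    HasHukuharaDerivWithinAt v ((-1 : ℝ) • u t + (-1 : ℝ) • v t) (Set.Ici 0) t

end FuzzySystem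

open Filter Topology Set
open scoped Pointwise

/-! ### Distributivity and continuity of `⊙` on fuzzy numbers. -/

namespace FuzzyNumber

/-! Write `s = u ⊕ v`. Then `E = s ⊕ (-1) ⊙ s` is symmetric, `(-1) ⊙ E = E`, so `Ã²(u,v) = (E, E)`.
Since `E ⊕ E = 2 ⊙ E`, it follows that `Ã^(p+2)(u,v) = 2^p ⊙ (E, E)` (`systemOperator_iterate`). For
`t ≥ 0` all coefficients of the series are nonnegative, where `⊙` does distribute over sums of
scalars, so every partial sum from the linear term on is exactly `fuzzyFlow` with `h(t)` replaced by
a partial sum of its power series. On the unit ball the error is at most `4 |h(t) - h_m(t)|`, which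
gives convergence in `Φ`. Two limits agree on the unit ball, hence everywhere by homogeneity. For
the system, `t ⊙ s ⊕ (-t) ⊙ s = t ⊙ E` gives `u(t) ⊕ v(t) = s ⊕ (t + 2h(t)) ⊙ E`, and `h' = t + 2h`.
Since `h` is nondecreasing on `[0,∞)`, the increments of `u` and `v` split off as summands, so the
Hukuhara differences exist and their quotients converge. -/

lemma add_smul_of_nonneg {c d : ℝ} (hc : 0 ≤ c) (hd : 0 ≤ d) (u : FuzzyNumber) :
    (c + d) • u = c • u + d • u := ext_lo_hi fun r hr => by
  simp only [lo_add _ _ hr, hi_add _ _ hr, lo_smul_nonneg hc _ hr, hi_smul_nonneg hc _ hr,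
    lo_smul_nonneg hd _ hr, hi_smul_nonneg hd _ hr, lo_smul_nonneg (add_nonneg hc hd) _ hr,
    hi_smul_nonneg (add_nonneg hc hd) _ hr, add_mul, and_self]

/-- Scalar multiplication of fuzzy numbers is a distributive action of the monoid `ℝ`, although it
does not distribute over the addition of scalars. -/
noncomputable instance : DistribMulAction ℝ FuzzyNumber where
  one_smul u := ext_level fun r hr => by rw [level_smul _ _ hr, one_smul]
  mul_smul c d u := ext_level fun r hr => by
    rw [level_smul _ _ hr, level_smul _ _ hr, level_smul _ _ hr, mul_smul]
  smul_zero c := ext_level fun r hr => by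
    rw [level_smul _ _ hr, level_zero_number hr, Set.smul_set_singleton, smul_zero]
  smul_add c u v := ext_level fun r hr => by
    rw [level_smul _ _ hr, level_add _ _ hr.1, level_add _ _ hr.1, level_smul _ _ hr,
      level_smul _ _ hr, smul_add]

/-- All endpoints of `u` are bounded by `dist u 0`. If `c` and `d` have opposite signs the endpoints
are interchanged on one side only, but then `|c| + |d| = |c - d|`, so the same bound holds. -/
lemma dist_smul_smul_le (c d : ℝ) (u : FuzzyNumber) :
    dist (c • u) (d • u) ≤ |c - d| * dist u 0 := dist_le_of fun r hr => by
  have h := distAt_le_dist u 0 hr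
  simp only [distAt, max_le_iff, lo_zero hr, hi_zero hr, sub_zero] at h ⊢
  obtain ⟨⟨h1, h2⟩, h3, h4⟩ := And.intro (abs_le.1 h.1) (abs_le.1 h.2)
  rcases le_total 0 c with hc | hc <;> rcases le_total 0 d with hd | hd
  · simp only [lo_smul_nonneg hc _ hr, hi_smul_nonneg hc _ hr, lo_smul_nonneg hd _ hr,
      hi_smul_nonneg hd _ hr, ← sub_mul, abs_mul]
    exact ⟨mul_le_mul_of_nonneg_left h.1 (abs_nonneg _),
      mul_le_mul_of_nonneg_left h.2 (abs_nonneg _)⟩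
  · simp only [lo_smul_nonneg hc _ hr, hi_smul_nonneg hc _ hr, lo_smul_nonpos hd _ hr,
      hi_smul_nonpos hd _ hr, abs_of_nonneg (by linarith : 0 ≤ c - d)]
    constructor <;> rw [abs_le] <;> constructor <;> nlinarith
  · simp only [lo_smul_nonpos hc _ hr, hi_smul_nonpos hc _ hr, lo_smul_nonneg hd _ hr,
      hi_smul_nonneg hd _ hr, abs_of_nonpos (by linarith : c - d ≤ 0)]
    constructor <;> rw [abs_le] <;> constructor <;> nlinarith
  · simp only [lo_smul_nonpos hc _ hr, hi_smul_nonpos hc _ hr, lo_smul_nonpos hd _ hr,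
      hi_smul_nonpos hd _ hr, ← sub_mul, abs_mul]
    exact ⟨mul_le_mul_of_nonneg_left h.2 (abs_nonneg _),
      mul_le_mul_of_nonneg_left h.1 (abs_nonneg _)⟩

/-- Makes `⊙` continuous in the scalar, as the limits of Hukuhara quotients require. -/
instance : IsBoundedSMul ℝ FuzzyNumber where
  dist_smul_pair' c u v := by simpa [Real.dist_eq] using dist_smul_le' c u v
  dist_pair_smul' c d u := by simpa [Real.dist_eq] using dist_smul_smul_le c d u

end FuzzyNumber

/-! ### Transfer to `C([a,b]; ℝ_F)` and properties of `E`. -/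

section ContinuousFuzzy

variable {a b : ℝ}

lemma FuzzyC.add_smul {c d : ℝ} (hc : 0 ≤ c) (hd : 0 ≤ d) (u : FuzzyC a b) :
    (c + d) • u = c • u + d • u :=
  ContinuousMap.ext fun x => FuzzyNumber.add_smul_of_nonneg hc hd (u x)

lemma FuzzyC.zero_smul (u : FuzzyC a b) : (0 : ℝ) • u = 0 :=
  ContinuousMap.ext fun x => FuzzyNumber.zero_smul_def (u x)

lemma FuzzyC.dist_add_add_le (u v w e : FuzzyC a b) :
    dist (u + v) (w + e) ≤ dist u w + dist v e :=
  (ContinuousMap.dist_le (by positivity)).2 fun x =>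
    (FuzzyNumber.dist_add_add_le' _ _ _ _).trans
      (add_le_add (ContinuousMap.dist_apply_le_dist x) (ContinuousMap.dist_apply_le_dist x))

lemma FuzzyC.dist_smul_le (c : ℝ) (u v : FuzzyC a b) : dist (c • u) (c • v) ≤ |c| * dist u v :=
  (ContinuousMap.dist_le (by positivity)).2 fun x =>
    (FuzzyNumber.dist_smul_le' _ _ _).trans
      (mul_le_mul_of_nonneg_left (ContinuousMap.dist_apply_le_dist x) (abs_nonneg _))

lemma FuzzyC.dist_smul_smul_le (c d : ℝ) (u : FuzzyC a b) :
    dist (c • u) (d • u) ≤ |c - d| * dist u 0 :=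
  (ContinuousMap.dist_le (by positivity)).2 fun x =>
    (FuzzyNumber.dist_smul_smul_le _ _ _).trans
      (mul_le_mul_of_nonneg_left (ContinuousMap.dist_apply_le_dist (f := u) (g := 0) x)
        (abs_nonneg _))

/-- Multiplication by `-1` swaps the two summands of `E`. -/
lemma neg_one_smul_fuzzyE (u v : FuzzyC a b) : (-1 : ℝ) • fuzzyE u v = fuzzyE u v := by
  simp only [fuzzyE]
  generalize u + v = s
  rw [smul_add, smul_smul, neg_mul_neg, one_mul, one_smul, add_comm]

lemma fuzzyE_add (u v u' v' : FuzzyC a b) :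
    fuzzyE (u + u') (v + v') = fuzzyE u v + fuzzyE u' v' := by
  simp only [fuzzyE, smul_add]
  abel

lemma fuzzyE_smul (c : ℝ) (u v : FuzzyC a b) : fuzzyE (c • u) (c • v) = c • fuzzyE u v := by
  simp only [fuzzyE, smul_add, smul_comm c (-1 : ℝ)]

lemma dist_fuzzyE_zero_le (u v : FuzzyC a b) :
    dist (fuzzyE u v) 0 ≤ 2 * (dist u 0 + dist v 0) := by
  have h1 := FuzzyC.dist_add_add_le u v 0 0
  have h2 := FuzzyC.dist_add_add_le (u + v) ((-1 : ℝ) • (u + v)) 0 ((-1 : ℝ) • 0)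
  have h3 := FuzzyC.dist_smul_le (-1) (u + v) 0
  simp only [smul_zero, add_zero, abs_neg, abs_one, one_mul] at *
  unfold fuzzyE
  linarith

/-- The operator `(u, v) ↦ (u ⊕ t ⊙ (u ⊕ v) ⊕ c ⊙ E(u,v), v ⊕ (-t) ⊙ (u ⊕ v) ⊕ c ⊙ E(u,v))`. -/
noncomputable def fuzzyFlow (t c : ℝ) (w : FuzzyC a b × FuzzyC a b) : FuzzyC a b × FuzzyC a b :=
  (w.1 + t • (w.1 + w.2) + c • fuzzyE w.1 w.2, w.2 + (-t) • (w.1 + w.2) + c • fuzzyE w.1 w.2)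

lemma isFuzzyOperator_systemOperator : IsFuzzyOperator (systemOperator a b) where
  map_add x y := by
    ext1 <;> simp only [systemOperator, Prod.fst_add, Prod.snd_add, smul_add] <;> abel
  map_smul c x := by
    ext1 <;> simp only [systemOperator, Prod.smul_fst, Prod.smul_snd, smul_add,
      smul_comm c (-1 : ℝ)]
  continuous := by unfold systemOperator; fun_prop

lemma isFuzzyOperator_fuzzyFlow (t c : ℝ) : IsFuzzyOperator (fuzzyFlow (a := a) (b := b) t c) where
  map_add x y := by
    ext1 <;> simp only [fuzzyFlow, Prod.fst_add, Prod.snd_add, smul_add, fuzzyE_add] <;> abel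
  map_smul d x := by
    ext1 <;> simp only [fuzzyFlow, Prod.smul_fst, Prod.smul_snd, smul_add, fuzzyE_smul,
      smul_comm d]
  continuous := by unfold fuzzyFlow fuzzyE; fun_prop

/-! ### Powers of `Ã` and the exponential series. -/

lemma two_smul_fuzzyC (u : FuzzyC a b) : (2 : ℝ) • u = u + u := by
  rw [← one_add_one_eq_two, FuzzyC.add_smul zero_le_one zero_le_one, one_smul]

lemma systemOperator_iterate (w : FuzzyC a b × FuzzyC a b) (p : ℕ) :
    (systemOperator a b)^[p + 2] w = (2 ^ p : ℝ) • (fuzzyE w.1 w.2, fuzzyE w.1 w.2) := by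
  induction p with
  | zero =>
    rw [pow_zero, one_smul]
    change systemOperator a b (systemOperator a b w) = _
    ext1
    · rfl
    · exact neg_one_smul_fuzzyE w.1 w.2
  | succ p ih =>
    rw [show p + 1 + 2 = (p + 2) + 1 from rfl, Function.iterate_succ_apply', ih,
      isFuzzyOperator_systemOperator.map_smul, pow_succ, mul_smul]
    congr 1
    ext1
    · simp only [systemOperator, Prod.smul_fst, two_smul_fuzzyC]
    · simp only [systemOperator, Prod.smul_snd, two_smul_fuzzyC, smul_add, neg_one_smul_fuzzyE]

/-- The partial sums of the power series `∑ 2 ^ p t ^ (p + 2) / (p + 2)!` of `hFun`. -/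
noncomputable def hPartialSum (t : ℝ) (m : ℕ) : ℝ :=
  ∑ p ∈ Finset.range m, t ^ (p + 2) / ((p + 2).factorial : ℝ) * 2 ^ p

lemma hPartialSum_nonneg {t : ℝ} (ht : 0 ≤ t) (m : ℕ) : 0 ≤ hPartialSum t m :=
  Finset.sum_nonneg fun _ _ => by positivity

/-- The terms are those of the series of `e^(2t)` from order two on, divided by `4`. -/
lemma tendsto_hPartialSum (t : ℝ) : Tendsto (hPartialSum t) atTop (𝓝 (hFun t)) := by
  have h : HasSum (fun n : ℕ => (2 * t) ^ n / (n.factorial : ℝ)) (Real.exp (2 * t)) := by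
    rw [Real.exp_eq_exp_ℝ]
    exact NormedSpace.expSeries_div_hasSum_exp (2 * t)
  have h' := (((tendsto_add_atTop_iff_nat 2).2 h.tendsto_sum_nat).sub_const
    (1 + 2 * t)).div_const 4
  have e : (Real.exp (2 * t) - (1 + 2 * t)) / 4 = hFun t := by unfold hFun; ring
  rw [e] at h'
  refine h'.congr fun m => ?_
  rw [Finset.sum_range_succ', Finset.sum_range_succ', hPartialSum]
  simp only [zero_add, pow_zero, pow_one, Nat.factorial_zero, Nat.factorial_one, Nat.cast_one,
    div_one, add_assoc, one_add_one_eq_two]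
  -- The added zeros only fit the shape of the next identity, in which the terms `1` and `2t` split
  -- off above cancel.
  rw [← add_sub_add_right_eq_sub _ _ 0]
  have : ∀ x : ℝ, (x + (2 * t + 1) + 0 - (1 + (2 * t + 0))) / 4 = x / 4 := fun x => by ring
  simp only [add_assoc] at this ⊢
  rw [this, Finset.sum_div]
  refine Finset.sum_congr rfl fun p _ => ?_
  rw [mul_pow, pow_add (2 : ℝ)]
  ring

/-- The terms of order zero and one give the flow with empty coefficient sum, hence the index `m +
1`. Each later term is a nonnegative multiple of `(E, E)`; `t ≥ 0` allows it to be merged into the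
coefficient of `E`. -/
lemma expPartialSum_systemOperator {t : ℝ} (ht : 0 ≤ t) (m : ℕ) :
    expPartialSum (systemOperator a b) t (m + 1) = fuzzyFlow t (hPartialSum t m) := by
  funext w
  induction m with
  | zero =>
    simp only [expPartialSum, Finset.sum_range_succ, Finset.sum_range_zero, hPartialSum, fuzzyFlow,
      FuzzyC.zero_smul, zero_add, add_zero, pow_zero, pow_one, Nat.factorial_zero,
      Nat.factorial_one, Nat.cast_one, div_one, one_smul, Function.iterate_zero, id,
      Function.iterate_one]
    ext1
    · rfl
    · simp only [systemOperator, Prod.snd_add, Prod.smul_snd, smul_smul, mul_neg, mul_one]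
  | succ m ih =>
    have hs : hPartialSum t (m + 1) =
        hPartialSum t m + t ^ (m + 2) / ((m + 2).factorial : ℝ) * 2 ^ m :=
      Finset.sum_range_succ _ _
    have he : expPartialSum (systemOperator a b) t (m + 1 + 1) w =
        expPartialSum (systemOperator a b) t (m + 1) w +
          (t ^ (m + 2) / ((m + 2).factorial : ℝ)) • (systemOperator a b)^[m + 2] w :=
      Finset.sum_range_succ _ _
    rw [he, ih, systemOperator_iterate, smul_smul, hs]
    ext1 <;> simp only [fuzzyFlow, Prod.fst_add, Prod.snd_add, Prod.smul_fst, Prod.smul_snd,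
      FuzzyC.add_smul (hPartialSum_nonneg ht m)
        (by positivity : 0 ≤ t ^ (m + 2) / ((m + 2).factorial : ℝ) * 2 ^ m), add_assoc]

/-! ### Convergence in `Φ` and uniqueness of the limit. -/

lemma operatorDist_fuzzyFlow_le (t c d : ℝ) :
    operatorDist (fuzzyFlow (a := a) (b := b) t c) (fuzzyFlow t d) ≤
      ENNReal.ofReal (|c - d| * 4) := by
  refine iSup₂_le fun w hw => ?_
  rw [edist_dist]
  refine ENNReal.ofReal_le_ofReal ?_
  rw [dist_comm, Prod.dist_eq, max_le_iff] at hw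
  -- Both components of `w` lie within `1` of zero, so the bound for `E` is `2 * (1 + 1)`.
  have hE : dist (fuzzyE w.1 w.2) 0 ≤ 4 := by
    have h := dist_fuzzyE_zero_le w.1 w.2
    have h1 : dist w.1 0 ≤ 1 := hw.1
    have h2 : dist w.2 0 ≤ 1 := hw.2
    linarith
  have key : ∀ x : FuzzyC a b,
      dist (x + c • fuzzyE w.1 w.2) (x + d • fuzzyE w.1 w.2) ≤ |c - d| * 4 := fun x => by
    refine (FuzzyC.dist_add_add_le _ _ _ _).trans ?_
    rw [dist_self, zero_add]
    exact (FuzzyC.dist_smul_smul_le _ _ _).trans (mul_le_mul_of_nonneg_left hE (abs_nonneg _))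
  exact max_le (key _) (key _)

lemma isFuzzyExp_systemOperator {t : ℝ} (ht : 0 ≤ t) :
    IsFuzzyExp (systemOperator a b) t (fuzzyFlow t (hFun t)) where
  isFuzzyOperator := isFuzzyOperator_fuzzyFlow _ _
  tendsto := by
    rw [← tendsto_add_atTop_iff_nat 1]
    have h : Tendsto (fun m => ENNReal.ofReal (|hFun t - hPartialSum t m| * 4)) atTop (𝓝 0) := by
      have h1 := (((tendsto_hPartialSum t).const_sub (hFun t)).abs.mul_const 4)
      rw [sub_self, abs_zero, zero_mul] at h1
      simpa using ENNReal.tendsto_ofReal h1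
    refine tendsto_of_tendsto_of_tendsto_of_le_of_le tendsto_const_nhds h (fun _ => zero_le)
      fun m => ?_
    simp only [expPartialSum_systemOperator ht]
    exact operatorDist_fuzzyFlow_le _ _ _

lemma dist_zero_smul_le (c : ℝ) (w : FuzzyC a b × FuzzyC a b) :
    dist 0 (c • w) ≤ |c| * dist 0 w := by
  have h1 := FuzzyC.dist_smul_le c 0 w.1
  have h2 := FuzzyC.dist_smul_le c 0 w.2
  rw [smul_zero] at h1 h2
  exact max_le (h1.trans (mul_le_mul_of_nonneg_left (le_max_left _ _) (abs_nonneg c)))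
    (h2.trans (mul_le_mul_of_nonneg_left (le_max_right _ _) (abs_nonneg c)))

/-- The exponential of an operator on `C([a,b]; ℝ_F)²` is unique. -/
lemma IsFuzzyExp.unique {A T T' : FuzzyC a b × FuzzyC a b → FuzzyC a b × FuzzyC a b} {t : ℝ}
    (h : IsFuzzyExp A t T) (h' : IsFuzzyExp A t T') : T = T' := by
  have ball : ∀ w, dist 0 w ≤ 1 → T w = T' w := fun w hw => by
    have hlim := h.tendsto.add h'.tendsto
    rw [add_zero] at hlim
    rw [← edist_le_zero]
    refine ge_of_tendsto' hlim fun m => ?_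
    refine (edist_triangle_right _ _ (expPartialSum A t m w)).trans (add_le_add ?_ ?_)
    · exact le_iSup₂ (f := fun x (_ : dist 0 x ≤ 1) => edist (T x) (expPartialSum A t m x)) w hw
    · exact le_iSup₂ (f := fun x (_ : dist 0 x ≤ 1) => edist (T' x) (expPartialSum A t m x)) w hw
  funext w
  -- The `+ 1` keeps `c` positive at `w = 0`, while `c⁻¹ ⊙ w` still lies in the unit ball.
  set c : ℝ := dist 0 w + 1
  have hc : 0 < c := by positivity
  have hw : dist 0 (c⁻¹ • w) ≤ 1 := by
    refine (dist_zero_smul_le _ _).trans ?_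
    rw [abs_of_pos (inv_pos.2 hc), inv_mul_le_iff₀ hc, mul_one]
    exact (lt_add_one _).le
  have e := congrArg (c • ·) (ball _ hw)
  simpa only [← h.isFuzzyOperator.map_smul, ← h'.isFuzzyOperator.map_smul, smul_smul,
    mul_inv_cancel₀ hc.ne', one_smul] using e

/-! ### The function `h` and Hukuhara derivatives. -/

/-- With `δ = t - s`, the difference is `(e^(2s) (e^(2δ) - 1) - 2δ) / 4`, where `e^(2s) ≥ 1` and
`e^(2δ) - 1 ≥ 2δ`. Nonnegative increments of `h` are what makes the Hukuhara differences exist. -/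
lemma hFun_mono {s t : ℝ} (hs : 0 ≤ s) (hst : s ≤ t) : hFun s ≤ hFun t := by
  have h1 := Real.add_one_le_exp (2 * (t - s))
  have h2 : Real.exp (2 * t) = Real.exp (2 * s) * Real.exp (2 * (t - s)) := by
    rw [← Real.exp_add]; ring_nf
  have h3 : 1 ≤ Real.exp (2 * s) := Real.one_le_exp (by linarith)
  unfold hFun
  nlinarith

lemma hFun_zero : hFun 0 = 0 := by simp [hFun]

lemma hFun_nonneg {t : ℝ} (ht : 0 ≤ t) : 0 ≤ hFun t := hFun_zero ▸ hFun_mono le_rfl ht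

/-- The derivative is written as `t + 2h` to match the coefficient of `E` in `u(t) ⊕ v(t)`. -/
lemma hasDerivAt_hFun (t : ℝ) : HasDerivAt hFun (t + 2 * hFun t) t := by
  have h := (((hasDerivAt_id t).const_mul 2).exp.sub ((hasDerivAt_id t).const_mul 2)
    |>.sub_const 1).div_const 4
  refine h.congr_deriv ?_
  simp only [hFun, id]
  ring

/-- A function that grows by `σ h ⊙ s ⊕ (g(t+h) - g(t)) ⊙ e` over `[t, t + h]`
has Hukuhara derivative `σ ⊙ s ⊕ g'(t) ⊙ e`. -/
lemma hasHukuharaDerivWithinAt_of_increment {f : ℝ → FuzzyC a b} {s e : FuzzyC a b} {σ : ℝ}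
    {g : ℝ → ℝ} {g' t : ℝ} (ht : 0 ≤ t) (hg : HasDerivAt g g' t)
    (hf : ∀ r k, 0 ≤ r → 0 ≤ k → f (r + k) = f r + ((k * σ) • s + (g (r + k) - g r) • e)) :
    HasHukuharaDerivWithinAt f (σ • s + g' • e) (Ici 0) t := by
  -- The increment formula holds for steps of any size, so the threshold `1` is arbitrary. The two
  -- witnesses are the increments over `[t, t + k]` and `[t - k, t]`.
  refine ⟨1, one_pos, fun k => (k * σ) • s + (g (t + k) - g t) • e,
    fun k => (k * σ) • s + (g t - g (t - k)) • e, fun k hk _ _ => hf t k ht hk.le,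
    fun k hk _ hm => ?_, ?_, ?_⟩
  · have := hf (t - k) k hm hk.le
    rwa [sub_add_cancel] at this
  all_goals rw [← tendsto_iff_dist_tendsto_zero]
  · have hs : Tendsto (fun k => k⁻¹ * (g (t + k) - g t)) (𝓝[{h | 0 < h ∧ t + h ∈ Ici 0}] 0)
        (𝓝 g') := by
      refine (hasDerivAt_iff_tendsto_slope_zero.1 hg).mono_left (nhdsWithin_mono _ ?_)
      exact fun k hk => hk.1.ne'
    -- After scaling by `1/k` the `s`-part is constantly `σ ⊙ s`; only the difference quotient of
    -- `g` varies.
    refine ((hs.smul_const e).const_add (σ • s)).congr' ?_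
    filter_upwards [self_mem_nhdsWithin] with k hk
    rw [smul_add, smul_smul, smul_smul, one_div, inv_mul_cancel_left₀ hk.1.ne']
  · have hs : Tendsto (fun k => k⁻¹ * (g t - g (t - k))) (𝓝[{h | 0 < h ∧ t - h ∈ Ici 0}] 0)
        (𝓝 g') := by
      -- The backward quotient is the slope of `g` at `t` for the increment `-k`. At `t = 0` the
      -- filter is trivial.
      have hneg : Tendsto (fun k : ℝ => -k) (𝓝[{h | 0 < h ∧ t - h ∈ Ici 0}] 0) (𝓝[≠] 0) := by
        refine tendsto_nhdsWithin_iff.2 ⟨?_, ?_⟩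
        · have : Tendsto (fun k : ℝ => -k) (𝓝 0) (𝓝 0) := by simpa using tendsto_neg (0 : ℝ)
          exact this.mono_left nhdsWithin_le_nhds
        · filter_upwards [self_mem_nhdsWithin] with k hk
          exact neg_ne_zero.2 hk.1.ne'
      refine ((hasDerivAt_iff_tendsto_slope_zero.1 hg).comp hneg).congr fun k => ?_
      simp only [Function.comp, smul_eq_mul, inv_neg, sub_eq_add_neg]
      ring
    refine ((hs.smul_const e).const_add (σ • s)).congr' ?_
    filter_upwards [self_mem_nhdsWithin] with k hk
    rw [smul_add, smul_smul, smul_smul, one_div, inv_mul_cancel_left₀ hk.1.ne']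

lemma hFun_smul_add {r k : ℝ} (hr : 0 ≤ r) (hk : 0 ≤ k) (u : FuzzyC a b) :
    hFun (r + k) • u = hFun r • u + (hFun (r + k) - hFun r) • u := by
  rw [← FuzzyC.add_smul (hFun_nonneg hr)
    (sub_nonneg.2 (hFun_mono hr (le_add_of_nonneg_right hk))), add_sub_cancel]

lemma neg_smul_eq (r : ℝ) (u : FuzzyC a b) : (-r) • u = r • (-1 : ℝ) • u := by
  rw [smul_smul, mul_neg_one]

/-- The terms `t ⊙ s` and `(-t) ⊙ s` do not cancel: together they form `t ⊙ E`. -/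
lemma fuzzyFlow_fst_add_snd {t : ℝ} (ht : 0 ≤ t) (u v : FuzzyC a b) :
    (u + t • (u + v) + hFun t • fuzzyE u v) + (v + (-t) • (u + v) + hFun t • fuzzyE u v) =
      (u + v) + (t + 2 * hFun t) • fuzzyE u v := by
  have h := hFun_nonneg ht
  have e : t • fuzzyE u v = t • (u + v) + (-t) • (u + v) := by
    rw [neg_smul_eq, ← smul_add]; rfl
  rw [two_mul, FuzzyC.add_smul ht (add_nonneg h h), FuzzyC.add_smul h h, e]
  generalize t • (u + v) = x
  generalize (-t) • (u + v) = y
  abel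

lemma isSystemSolution_fuzzyFlow (u₀ v₀ : FuzzyC a b) :
    IsSystemSolution u₀ v₀
      (fun t => u₀ + t • (u₀ + v₀) + hFun t • fuzzyE u₀ v₀)
      (fun t => v₀ + (-t) • (u₀ + v₀) + hFun t • fuzzyE u₀ v₀) where
  init_u := by simp only [hFun_zero, FuzzyC.zero_smul, add_zero]
  init_v := by simp only [hFun_zero, neg_zero, FuzzyC.zero_smul, add_zero]
  deriv_u t ht := by
    rw [fuzzyFlow_fst_add_snd ht]
    -- Exhibits the rate `σ = 1`.
    conv in u₀ + v₀ + _ => rw [← one_smul ℝ (u₀ + v₀)]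
    refine hasHukuharaDerivWithinAt_of_increment ht (hasDerivAt_hFun t) fun r k hr hk => ?_
    simp only [hFun_smul_add hr hk, FuzzyC.add_smul hr hk, mul_one]
    generalize u₀ + v₀ = s
    abel
  deriv_v t ht := by
    -- By symmetry of `E`, the factor `-1` only reaches `u₀ ⊕ v₀`; the rate is `σ = -1`.
    rw [← smul_add, fuzzyFlow_fst_add_snd ht, smul_add, smul_comm, neg_one_smul_fuzzyE]
    refine hasHukuharaDerivWithinAt_of_increment ht (hasDerivAt_hFun t) fun r k hr hk => ?_
    -- Moving the sign into the vector leaves the nonnegative scalars `r` and `k`, for which `⊙`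
    -- distributes.
    simp only [hFun_smul_add hr hk, neg_smul_eq (r + k), FuzzyC.add_smul hr hk, mul_neg_one,
      neg_smul_eq r, neg_smul_eq k]
    abel

end ContinuousFuzzy

theorem mainTheorem10 (a b : ℝ) :
    IsFuzzyOperator (systemOperator a b) ∧
    (∀ t : ℝ, 0 ≤ t → ∀ T : FuzzyC a b × FuzzyC a b → FuzzyC a b × FuzzyC a b,
      IsFuzzyExp (systemOperator a b) t T ↔
        ∀ u₀ v₀ : FuzzyC a b, T (u₀, v₀) =
          (u₀ + t • (u₀ + v₀) + hFun t • fuzzyE u₀ v₀,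
            v₀ + (-t) • (u₀ + v₀) + hFun t • fuzzyE u₀ v₀)) ∧
    ∀ u₀ v₀ : FuzzyC a b,
      IsSystemSolution u₀ v₀
        (fun t => u₀ + t • (u₀ + v₀) + hFun t • fuzzyE u₀ v₀)
        (fun t => v₀ + (-t) • (u₀ + v₀) + hFun t • fuzzyE u₀ v₀) := by

  refine ⟨isFuzzyOperator_systemOperator, fun t ht T => ⟨fun h u₀ v₀ => ?_, fun h => ?_⟩,
    isSystemSolution_fuzzyFlow⟩
  · rw [h.unique (isFuzzyExp_systemOperator ht)]
    rfl
  · have hT : T = fuzzyFlow t (hFun t) := funext fun w => h w.1 w.2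
    exact hT ▸ isFuzzyExp_systemOperator ht
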